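/- Consider a normed plane, that is, $\mathbb{R}^2$ with a norm whose unit ball is $U$ (a compact convex set with non-empty interior and $U=-U$). Write $[a,b]$ for the determinant of the matrix with columns $a,b\in\mathbb{R}^2$ and $A(\cdot)$ for area, and let $\|v\|_*=\sup\{|[x,v]| : x\in U\}$ be the dual norm on $\mathbb{R}^2$, where $v$ represents the functional $x\mapsto[x,v]$. Let $K$ be a convex polygon (with non-empty interior) with vertices $p_1,\dots,p_n$ in counterclockwise order, $n\ge 3$, $p_{n+1}=p_1$, and sides $e_i=p_{i+1}-p_i$. Its dual length is $L_*(K)=\sum_{i=1}^n\|e_i\|_*$. Let $K_1=\bigcap_{i=1}^n\{x : [x,e_i]\le \max_{u\in U}[u,e_i]\}$ be the polygon circumscribed about the unit circle $\partial U$ with sides respectively parallel to those of $K$, and let $K_1^0=K_1\cap(-K_1)$ be its symmetrization. Then $$\frac{L_*(K)^2}{4A(K_1^0)}\ \ge\ A(K),$$ with equality if and only if $K$ is, up to a translation, a positive multiple of $K_1^0$, i.e. $K=x+cK_1^0$ for some $x\in\mathbb{R}^2$ and $c>0$. -/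

import Mathlib

open scoped Pointwise

namespace NormedPlane

noncomputable section

/-- The determinant `[a, b]` of the `2 × 2` matrix with columns `a`, `b`. -/
def bracket (a b : ℝ × ℝ) : ℝ := a.1 * b.2 - a.2 * b.1

/-- `U` is the closed unit ball of some norm on the plane `ℝ²`: an origin-symmetric
compact convex set with non-empty interior. -/
structure IsUnitBall (U : Set (ℝ × ℝ)) : Prop where
  convex : Convex ℝ U
  isCompact : IsCompact U
  symmetric : ∀ x ∈ U, -x ∈ U
  interior_nonempty : (interior U).Nonempty

/-- The dual norm of the functional `x ↦ [x, v]`, carried over to the vector `v` that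
represents it: `sup { |[x, v]| : x ∈ U }`. -/
def dualNorm (U : Set (ℝ × ℝ)) (v : ℝ × ℝ) : ℝ :=
  sSup ((fun x => |bracket x v|) '' U)

/-- The closed half-plane `{x : [x, e] ≤ max_{u ∈ U} [u, e]}`: it contains `U`, its boundary is
a support line of `U` parallel to `e`, and it lies to the left of this line directed by `e`. -/
def supportHalfPlane (U : Set (ℝ × ℝ)) (e : ℝ × ℝ) : Set (ℝ × ℝ) :=
  {x | bracket x e ≤ sSup ((fun u => bracket u e) '' U)}

/-- The area (Lebesgue measure) of a subset of the plane. -/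
def area (S : Set (ℝ × ℝ)) : ℝ := (MeasureTheory.volume S).toReal

variable {n : ℕ}

/-- The `i`-th side of a polygon, as a vector from a vertex to the cyclically next one. -/
def side (P : Polygon (ℝ × ℝ) n) (i : Fin n) : ℝ × ℝ := P (finRotate n i) - P i

/-- `P` lists the vertices of a (non-degenerate) convex polygon in counterclockwise order:
there are at least three of them, and every vertex not on the `i`-th side lies strictly to
the left of the line through that side. -/
def IsConvexPolygon (P : Polygon (ℝ × ℝ) n) : Prop :=
  3 ≤ n ∧ ∀ i j : Fin n, j ≠ i → j ≠ finRotate n i → 0 < bracket (side P i) (P j - P i)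

/-- The closed region enclosed by a convex polygon. -/
def region (P : Polygon (ℝ × ℝ) n) : Set (ℝ × ℝ) := convexHull ℝ (Set.range P.vertices)

/-- The dual length of a polygon: the length of its boundary measured in the dual norm. -/
def dualLength (U : Set (ℝ × ℝ)) (P : Polygon (ℝ × ℝ) n) : ℝ := ∑ i, dualNorm U (side P i)

/-- The polygon `K₁` circumscribed about `U` whose sides are respectively parallel to those
of the convex polygon `P`, with the same outer normals: the intersection of the corresponding
support half-planes of `U`. -/
def circumscribed (U : Set (ℝ × ℝ)) (P : Polygon (ℝ × ℝ) n) : Set (ℝ × ℝ) :=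
  ⋂ i, supportHalfPlane U (side P i)

/-- The symmetrization `K₁⁰ = K₁ ∩ (-K₁)`. -/
def symmCircumscribed (U : Set (ℝ × ℝ)) (P : Polygon (ℝ × ℝ) n) : Set (ℝ × ℝ) :=
  circumscribed U P ∩ -circumscribed U P

end

end NormedPlane

/-! Choose `r > 0` and `x` so that `M = x + r K₁⁰` has the same vertical extent as `K`, and put `h i
= [x, e_i] + r‖e_i‖_*`, so that `[m, e_i] ≤ h i` on `M`. The core is `IsMatched.area_add_area_le`:
`A(K) + A(M) ≤ ∑ h i`, a mixed-area inequality. At almost every height in the common range exactly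
one side of `K` goes up and one goes down, and their two half-planes bound the section of `M` by
`sliceBound`. Integrating gives at most `∑ h i - A(K)`; for `K` itself the sections are exact, which
yields `∑ sideLevel = 2 A(K)`.

The sides sum to zero, so `∑ h i = r L_*`, and AM-GM gives `4 A(K) r² A(K₁⁰) ≤ (A(K) + r² A(K₁⁰))² ≤
r² L_*²`; now cancel `r²`.

In the equality case `A(M) = A(K)` and almost all section bounds are attained. Closedness of `M`
then places each side of `K`, shifted horizontally to its line `[x, e_i] = h i`, in `M`. The shift
is constant along the rising sides and along the falling sides, and equality of areas makes the two
constants agree. So a translate of `K` lies in `M` with the same area, hence equals `M`. Conversely,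
for `K = x + c K₁⁰` the levels `sideLevel` and `h` (with `r = c`) coincide, so `2 A(K) = c L_*`
while `A(K) = c² A(K₁⁰)`. -/

open scoped Interval

namespace NormedPlane

open MeasureTheory Set

/-! ### Sides of a convex polygon crossing a horizontal line -/

section Polygon

variable {n : ℕ} {P : Polygon (ℝ × ℝ) n}

open scoped Fin.NatCast in
/-- A property of vertices that passes to the next vertex and holds at one vertex holds at all. -/
lemma finRotate_induction {S : Fin n → Prop} (hS : ∀ i, S i → S (finRotate n i)) {a : Fin n}
    (ha : S a) (b : Fin n) : S b := by
  obtain _ | m := n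
  · exact a.elim0
  have key : ∀ k : ℕ, S (a + ((k : ℕ) : Fin (m + 1))) := by
    intro k
    induction k with
    | zero => simpa using ha
    | succ k ih =>
      have := hS _ ih
      rw [finRotate_apply] at this
      rwa [Nat.cast_succ, ← add_assoc]
  have := key (b - a).val
  rwa [Fin.cast_val_eq_self, add_sub_cancel] at this

/-- Otherwise lying below `t` would propagate around the whole polygon. The half-open convention
matches that of `Ι`. -/
lemma exists_up_side {a b : Fin n} {t : ℝ} (ha : (P a).2 < t) (hb : t ≤ (P b).2) :
    ∃ i, (P i).2 < t ∧ t ≤ (P (finRotate n i)).2 := by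
  by_contra! h
  exact (finRotate_induction (S := fun i => (P i).2 < t) h ha b).not_ge hb

lemma exists_down_side {a b : Fin n} {t : ℝ} (ha : (P a).2 < t) (hb : t ≤ (P b).2) :
    ∃ i, (P (finRotate n i)).2 < t ∧ t ≤ (P i).2 := by
  by_contra! h
  refine (finRotate_induction (S := fun i => t ≤ (P i).2) (fun i hi => ?_) hb a).not_gt ha
  by_contra! h'
  exact (h i h').not_ge hi

lemma side_fst (i : Fin n) : (side P i).1 = (P (finRotate n i)).1 - (P i).1 := rfl

lemma side_snd (i : Fin n) : (side P i).2 = (P (finRotate n i)).2 - (P i).2 := rfl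

lemma sum_side : ∑ i, side P i = 0 := by
  simp only [side, Finset.sum_sub_distrib]
  rw [Equiv.sum_comp (finRotate n) (fun i => P i), sub_self]

/-- The abscissa at height `t` of the line `[x, e] = h`. -/
noncomputable def lineAbscissa (e : ℝ × ℝ) (h t : ℝ) : ℝ := (h + e.1 * t) / e.2

lemma le_lineAbscissa_iff {e : ℝ × ℝ} {h t x : ℝ} (he : 0 < e.2) :
    x ≤ lineAbscissa e h t ↔ bracket (x, t) e ≤ h := by
  rw [lineAbscissa, le_div_iff₀ he, bracket]
  constructor <;> intro H <;> linarith

lemma lineAbscissa_le_iff {e : ℝ × ℝ} {h t x : ℝ} (he : e.2 < 0) :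
    lineAbscissa e h t ≤ x ↔ bracket (x, t) e ≤ h := by
  rw [lineAbscissa, div_le_iff_of_neg he, bracket]
  constructor <;> intro H <;> linarith

/-- The value at the `i`-th vertex, hence on the whole `i`-th side, of the functional
`x ↦ [x, e_i]`. -/
noncomputable def sideLevel (P : Polygon (ℝ × ℝ) n) (i : Fin n) : ℝ := bracket (P i) (side P i)

lemma lineAbscissa_sideLevel {i : Fin n} (he : (side P i).2 ≠ 0) (t : ℝ) :
    lineAbscissa (side P i) (sideLevel P i) t =
      (P i).1 + (t - (P i).2) / (side P i).2 * (side P i).1 := by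
  rw [lineAbscissa, sideLevel, bracket]
  field_simp
  ring

lemma lineAbscissa_sideLevel_left {i : Fin n} (he : (side P i).2 ≠ 0) :
    lineAbscissa (side P i) (sideLevel P i) (P i).2 = (P i).1 := by
  simp [lineAbscissa_sideLevel he]

lemma lineAbscissa_sideLevel_right {i : Fin n} (he : (side P i).2 ≠ 0) :
    lineAbscissa (side P i) (sideLevel P i) (P (finRotate n i)).2 = (P (finRotate n i)).1 := by
  rw [lineAbscissa_sideLevel he, ← side_snd, div_self he, side_fst]
  ring

lemma lineAbscissa_mem_region {i : Fin n} {t : ℝ} (he : (side P i).2 ≠ 0)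
    (h0 : 0 ≤ (t - (P i).2) / (side P i).2) (h1 : (t - (P i).2) / (side P i).2 ≤ 1) :
    (lineAbscissa (side P i) (sideLevel P i) t, t) ∈ region P := by
  have hi : ∀ j, P j ∈ region P := fun j => subset_convexHull ℝ _ ⟨j, rfl⟩
  have := (convex_convexHull ℝ (range P.vertices)) (hi i) (hi (finRotate n i))
    (sub_nonneg.2 h1) h0 (by ring)
  rw [region]
  convert this using 1
  rw [lineAbscissa_sideLevel he]
  ext
  · simp only [Prod.fst_add, Prod.smul_fst, smul_eq_mul, side_fst]
    ring
  · simp only [Prod.snd_add, Prod.smul_snd, smul_eq_mul]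
    have : (P (finRotate n i)).2 = (P i).2 + (side P i).2 := by rw [side_snd]; ring
    rw [this]
    field_simp
    ring

lemma lineAbscissa_mem_region_of_up {i : Fin n} {t : ℝ} (he : 0 < (side P i).2)
    (h0 : (P i).2 ≤ t) (h1 : t ≤ (P (finRotate n i)).2) :
    (lineAbscissa (side P i) (sideLevel P i) t, t) ∈ region P := by
  refine lineAbscissa_mem_region he.ne' (div_nonneg (by linarith) he.le) ?_
  rw [div_le_one he, side_snd]
  linarith

lemma lineAbscissa_mem_region_of_down {i : Fin n} {t : ℝ} (he : (side P i).2 < 0)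
    (h0 : t ≤ (P i).2) (h1 : (P (finRotate n i)).2 ≤ t) :
    (lineAbscissa (side P i) (sideLevel P i) t, t) ∈ region P := by
  refine lineAbscissa_mem_region he.ne (div_nonneg_of_nonpos (by linarith) he.le) ?_
  rw [div_le_one_of_neg he, side_snd]
  linarith

lemma convex_bracket_le (e : ℝ × ℝ) (h : ℝ) : Convex ℝ {x | bracket x e ≤ h} := by
  intro x hx y hy a b ha hb hab
  simp only [bracket, mem_ofPred_eq, Prod.fst_add, Prod.snd_add, Prod.smul_fst, Prod.smul_snd,
    smul_eq_mul] at *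
  have hb' : b = 1 - a := by linarith
  subst hb'
  linarith [mul_le_mul_of_nonneg_left hx ha, mul_le_mul_of_nonneg_left hy hb]

namespace IsConvexPolygon

lemma bracket_nonneg (hP : IsConvexPolygon P) (i j : Fin n) :
    0 ≤ bracket (side P i) (P j - P i) := by
  by_cases h1 : j = i
  · simp [h1, bracket]
  by_cases h2 : j = finRotate n i
  · simp [h2, bracket, side, mul_comm]
  exact (hP.2 i j h1 h2).le

lemma bracket_le_of_mem_region (hP : IsConvexPolygon P) (i : Fin n) {x : ℝ × ℝ}
    (hx : x ∈ region P) : bracket x (side P i) ≤ sideLevel P i := by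
  refine convexHull_min ?_ (convex_bracket_le (side P i) (sideLevel P i)) hx
  rintro _ ⟨j, rfl⟩
  have := hP.bracket_nonneg i j
  simp only [mem_ofPred_eq, sideLevel, bracket, Prod.fst_sub, Prod.snd_sub] at *
  linarith

/-- The distance to the `i`-th side line is affine along the `j`-th side, so it interpolates the
values at the two ends. -/
lemma bracket_combination (i j : Fin n) (s : ℝ) :
    sideLevel P i - bracket (P j + s • side P j) (side P i) =
      (1 - s) * bracket (side P i) (P j - P i) +
        s * bracket (side P i) (P (finRotate n j) - P i) := by
  simp only [sideLevel, bracket, side, Prod.fst_sub, Prod.snd_sub, Prod.fst_add, Prod.snd_add,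
    Prod.smul_fst, Prod.smul_snd, smul_eq_mul]
  ring

lemma eq_or_eq_of_bracket_eq_zero (hP : IsConvexPolygon P) {i j : Fin n}
    (h : bracket (side P i) (P j - P i) = 0) : j = i ∨ j = finRotate n i := by
  by_contra! H
  exact (hP.2 i j H.1 H.2).ne' h

lemma lineAbscissa_point {j : Fin n} (he : (side P j).2 ≠ 0) (t : ℝ) :
    P j + ((t - (P j).2) / (side P j).2) • side P j =
      (lineAbscissa (side P j) (sideLevel P j) t, t) := by
  rw [lineAbscissa_sideLevel he]
  ext
  · simp
  · simp only [Prod.snd_add, Prod.smul_snd, smul_eq_mul]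
    field_simp
    ring

lemma bracket_lineAbscissa {e : ℝ × ℝ} (he : e.2 ≠ 0) (h t : ℝ) :
    bracket (lineAbscissa e h t, t) e = h := by
  rw [bracket, lineAbscissa]
  field_simp
  ring

/-- If two sides meet at height `t`, then the ends of the second one that carry a positive weight
there are ends of the first one. -/
lemma weights_eq_zero (hP : IsConvexPolygon P) {i j : Fin n} {t : ℝ} (ei : (side P i).2 ≠ 0)
    (ej : (side P j).2 ≠ 0)
    (h : lineAbscissa (side P i) (sideLevel P i) t = lineAbscissa (side P j) (sideLevel P j) t)
    (h0 : 0 ≤ (t - (P j).2) / (side P j).2) (h1 : (t - (P j).2) / (side P j).2 ≤ 1) :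
    (1 - (t - (P j).2) / (side P j).2) * bracket (side P i) (P j - P i) = 0 ∧
      (t - (P j).2) / (side P j).2 * bracket (side P i) (P (finRotate n j) - P i) = 0 := by
  have h4 := bracket_combination (P := P) i j ((t - (P j).2) / (side P j).2)
  rw [lineAbscissa_point ej, ← h, bracket_lineAbscissa ei, sub_self] at h4
  have h5 := mul_nonneg (sub_nonneg.2 h1) (hP.bracket_nonneg i j)
  have h6 := mul_nonneg h0 (hP.bracket_nonneg i (finRotate n j))
  constructor <;> linarith

/-- Each of the two points lies in the polygon, hence satisfies the inequality of the other side. -/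
lemma lineAbscissa_eq_of_up (hP : IsConvexPolygon P) {i j : Fin n} {t : ℝ}
    (ei : 0 < (side P i).2) (ej : 0 < (side P j).2)
    (hi : (P i).2 ≤ t ∧ t ≤ (P (finRotate n i)).2)
    (hj : (P j).2 ≤ t ∧ t ≤ (P (finRotate n j)).2) :
    lineAbscissa (side P i) (sideLevel P i) t = lineAbscissa (side P j) (sideLevel P j) t := by
  have h1 := hP.bracket_le_of_mem_region j (lineAbscissa_mem_region_of_up ei hi.1 hi.2)
  have h2 := hP.bracket_le_of_mem_region i (lineAbscissa_mem_region_of_up ej hj.1 hj.2)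
  rw [← le_lineAbscissa_iff ej] at h1
  rw [← le_lineAbscissa_iff ei] at h2
  exact le_antisymm h1 h2

lemma lineAbscissa_eq_of_down (hP : IsConvexPolygon P) {i j : Fin n} {t : ℝ}
    (ei : (side P i).2 < 0) (ej : (side P j).2 < 0)
    (hi : (P (finRotate n i)).2 ≤ t ∧ t ≤ (P i).2)
    (hj : (P (finRotate n j)).2 ≤ t ∧ t ≤ (P j).2) :
    lineAbscissa (side P i) (sideLevel P i) t = lineAbscissa (side P j) (sideLevel P j) t := by
  have h1 := hP.bracket_le_of_mem_region j (lineAbscissa_mem_region_of_down ei hi.2 hi.1)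
  have h2 := hP.bracket_le_of_mem_region i (lineAbscissa_mem_region_of_down ej hj.2 hj.1)
  rw [← lineAbscissa_le_iff ej] at h1
  rw [← lineAbscissa_le_iff ei] at h2
  exact le_antisymm h2 h1

/-- The sides meet at height `t`, strictly above the start of the `j`-th, so the end vertex of the
`j`-th carries positive weight and must be an end of the `i`-th. Its height excludes the lower end.
-/
lemma up_side_unique (hP : IsConvexPolygon P) {i j : Fin n} {t : ℝ}
    (hi : (P i).2 < t ∧ t ≤ (P (finRotate n i)).2)
    (hj : (P j).2 < t ∧ t ≤ (P (finRotate n j)).2) : i = j := by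
  have ei : 0 < (side P i).2 := by rw [side_snd]; linarith
  have ej : 0 < (side P j).2 := by rw [side_snd]; linarith
  have hs : 0 < (t - (P j).2) / (side P j).2 := div_pos (by linarith) ej
  have hs1 : (t - (P j).2) / (side P j).2 ≤ 1 := by
    rw [div_le_one ej, side_snd]
    linarith
  have h7 := (mul_eq_zero.1 (hP.weights_eq_zero ei.ne' ej.ne' (hP.lineAbscissa_eq_of_up ei ej
    ⟨hi.1.le, hi.2⟩ ⟨hj.1.le, hj.2⟩) hs.le hs1).2).resolve_left hs.ne'
  rcases hP.eq_or_eq_of_bracket_eq_zero h7 with h | h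
  · rw [h] at hj
    exact absurd hi.1 hj.2.not_gt
  · exact ((finRotate n).injective h).symm

lemma down_side_unique (hP : IsConvexPolygon P) {i j : Fin n} {t : ℝ}
    (hi : (P (finRotate n i)).2 < t ∧ t ≤ (P i).2)
    (hj : (P (finRotate n j)).2 < t ∧ t ≤ (P j).2) : i = j := by
  have ei : (side P i).2 < 0 := by rw [side_snd]; linarith
  have ej : (side P j).2 < 0 := by rw [side_snd]; linarith
  have hs : 0 ≤ (t - (P j).2) / (side P j).2 := div_nonneg_of_nonpos (by linarith) ej.le
  have hs1 : (t - (P j).2) / (side P j).2 < 1 := by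
    rw [div_lt_one_of_neg ej, side_snd]
    linarith
  have h7 := (mul_eq_zero.1 (hP.weights_eq_zero ei.ne ej.ne (hP.lineAbscissa_eq_of_down ei ej
    ⟨hi.1.le, hi.2⟩ ⟨hj.1.le, hj.2⟩) hs hs1.le).1).resolve_left (sub_pos.2 hs1).ne'
  rcases hP.eq_or_eq_of_bracket_eq_zero h7 with h | h
  · exact h.symm
  · rw [h] at hj
    exact absurd hi.1 hj.2.not_gt

end IsConvexPolygon
end Polygon

/-! ### Horizontal sections and the area of a polygon -/

/-- The length of the section of a planar set by the horizontal line at height `t`. -/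
noncomputable def sliceLength (M : Set (ℝ × ℝ)) (t : ℝ) : ℝ :=
  (volume ((fun x : ℝ => (x, t)) ⁻¹' M)).toReal

lemma lintegral_slice {M : Set (ℝ × ℝ)} (hM : MeasurableSet M) :
    ∫⁻ t : ℝ, volume ((fun x : ℝ => (x, t)) ⁻¹' M) = volume M := by
  rw [Measure.volume_eq_prod, Measure.prod_apply_symm hM]

lemma integrable_sliceLength {M : Set (ℝ × ℝ)} (hM : MeasurableSet M) (hf : volume M ≠ ⊤) :
    Integrable (sliceLength M) := by
  refine integrable_toReal_of_lintegral_ne_top (measurable_measure_prodMk_right hM).aemeasurable ?_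
  rwa [lintegral_slice hM]

lemma integral_sliceLength {M : Set (ℝ × ℝ)} (hM : MeasurableSet M) (hf : volume M ≠ ⊤) :
    ∫ t, sliceLength M t = area M := by
  have hm : Measurable fun t : ℝ => volume ((fun x : ℝ => (x, t)) ⁻¹' M) :=
    measurable_measure_prodMk_right hM
  have := integral_toReal (μ := volume) hm.aemeasurable
    (ae_lt_top hm (by rwa [lintegral_slice hM]))
  rw [lintegral_slice hM] at this
  exact this

lemma integrable_indicator_affine (a b h c d : ℝ) :
    Integrable ((Ι a b).indicator fun t => (h + c * t) / d) := by
  rw [integrable_indicator_iff measurableSet_uIoc]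
  have hc : Continuous fun t : ℝ => (h + c * t) / d := by fun_prop
  exact intervalIntegrable_iff.1 (hc.intervalIntegrable a b)

lemma integral_affine (a b h c d : ℝ) :
    ∫ t in a..b, (h + c * t) / d = (h * (b - a) + c * ((b ^ 2 - a ^ 2) / 2)) / d := by
  rw [intervalIntegral.integral_div, intervalIntegral.integral_add (by simp)
    (by apply Continuous.intervalIntegrable; fun_prop), intervalIntegral.integral_const_mul,
    integral_id, intervalIntegral.integral_const, smul_eq_mul]
  ring

lemma integral_indicator_affine {a b : ℝ} (h c : ℝ) (hab : b - a ≠ 0) :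
    ∫ t, (Ι a b).indicator (fun t => (h + c * t) / |b - a|) t = h + c * ((a + b) / 2) := by
  rw [integral_indicator measurableSet_uIoc]
  rcases lt_or_gt_of_ne hab with hlt | hgt
  · have hba : b ≤ a := by linarith
    rw [uIoc_of_ge hba, ← intervalIntegral.integral_of_le hba, integral_affine, abs_of_neg hlt]
    field_simp
    ring
  · have hba : a ≤ b := by linarith
    rw [uIoc_of_le hba, ← intervalIntegral.integral_of_le hba, integral_affine, abs_of_pos hgt]
    field_simp
    ring

section Polygon

variable {n : ℕ} {P : Polygon (ℝ × ℝ) n}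

/-- The length cut out on the horizontal line at height `t` by the half-planes
`[x, e_i] ≤ h_i` belonging to the sides of `P` that cross this height. -/
noncomputable def sliceBound (P : Polygon (ℝ × ℝ) n) (h : Fin n → ℝ) (t : ℝ) : ℝ :=
  ∑ i, (Ι (P i).2 (P (finRotate n i)).2).indicator
    (fun t => (h i + (side P i).1 * t) / |(side P i).2|) t

lemma integrable_sliceBound (P : Polygon (ℝ × ℝ) n) (h : Fin n → ℝ) :
    Integrable (sliceBound P h) :=
  integrable_finsetSum _ fun _ _ => integrable_indicator_affine _ _ _ _ _

lemma integral_sliceBound (P : Polygon (ℝ × ℝ) n) (h : Fin n → ℝ) :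
    ∫ t, sliceBound P h t = ∑ i, if (side P i).2 = 0 then 0 else
      h i + (side P i).1 * (((P i).2 + (P (finRotate n i)).2) / 2) := by
  simp only [sliceBound]
  rw [integral_finsetSum _ fun _ _ => integrable_indicator_affine _ _ _ _ _]
  refine Finset.sum_congr rfl fun i _ => ?_
  split_ifs with he
  -- A horizontal side contributes nothing: its denominator is `|0|`, and division by zero gives
  -- `0`.
  · rw [he]
    simp
  · exact integral_indicator_affine _ _ he

lemma sliceBound_eq_zero {h : Fin n → ℝ} {t : ℝ}
    (ht : (∀ i, t ≤ (P i).2) ∨ ∀ i, (P i).2 < t) : sliceBound P h t = 0 := by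
  refine Finset.sum_eq_zero fun i _ => indicator_of_notMem ?_ _
  rw [mem_uIoc]
  rcases ht with ht | ht
  · have := ht i
    have := ht (finRotate n i)
    rintro (h | h) <;> linarith [h.1]
  · have := ht i
    have := ht (finRotate n i)
    rintro (h | h) <;> linarith [h.2]

lemma IsConvexPolygon.sliceBound_eq (hP : IsConvexPolygon P) (h : Fin n → ℝ) {i j : Fin n} {t : ℝ}
    (hi : (P i).2 < t ∧ t ≤ (P (finRotate n i)).2)
    (hj : (P (finRotate n j)).2 < t ∧ t ≤ (P j).2) :
    sliceBound P h t = lineAbscissa (side P i) (h i) t - lineAbscissa (side P j) (h j) t := by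
  have ei : 0 < (side P i).2 := by rw [side_snd]; linarith
  have ej : (side P j).2 < 0 := by rw [side_snd]; linarith
  have hij : i ≠ j := by
    rintro rfl
    linarith
  rw [sliceBound, Finset.sum_eq_add i j hij, indicator_of_mem (mem_uIoc.2 (Or.inl hi)),
    indicator_of_mem (mem_uIoc.2 (Or.inr hj)), abs_of_pos ei, abs_of_neg ej, lineAbscissa,
    lineAbscissa, div_neg, sub_eq_add_neg]
  · rintro k - ⟨h1, h2⟩
    refine indicator_of_notMem ?_ _
    rw [mem_uIoc]
    rintro (hk | hk)
    · exact h1 (hP.up_side_unique hk hi)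
    · exact h2 (hP.down_side_unique hk hj)
  · simp
  · simp

/-- A section of a set contained in the half-planes `[x, e_i] ≤ h_i`. -/
lemma slice_subset {M : Set (ℝ × ℝ)} {h : Fin n → ℝ} (hM : ∀ x ∈ M, ∀ i, bracket x (side P i) ≤ h i)
    {i j : Fin n} (ei : 0 < (side P i).2) (ej : (side P j).2 < 0) (t : ℝ) :
    (fun x : ℝ => (x, t)) ⁻¹' M ⊆
      Icc (lineAbscissa (side P j) (h j) t) (lineAbscissa (side P i) (h i) t) := fun _ hx =>
  ⟨(lineAbscissa_le_iff ej).2 (hM _ hx j), (le_lineAbscissa_iff ei).2 (hM _ hx i)⟩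

lemma exists_up_down {t : ℝ} (ht : ¬((∀ i, t ≤ (P i).2) ∨ ∀ i, (P i).2 < t)) :
    ∃ i j, ((P i).2 < t ∧ t ≤ (P (finRotate n i)).2) ∧
      ((P (finRotate n j)).2 < t ∧ t ≤ (P j).2) := by
  push Not at ht
  obtain ⟨⟨a, ha⟩, b, hb⟩ := ht
  obtain ⟨i, hi⟩ := exists_up_side ha hb
  obtain ⟨j, hj⟩ := exists_down_side ha hb
  exact ⟨i, j, hi, hj⟩

lemma sliceLength_le_sub {M : Set (ℝ × ℝ)} {h : Fin n → ℝ} {t : ℝ}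
    (hM : ∀ x ∈ M, ∀ i, bracket x (side P i) ≤ h i) (hne : ∃ x, (x, t) ∈ M)
    {i j : Fin n} (ei : 0 < (side P i).2) (ej : (side P j).2 < 0) :
    sliceLength M t ≤ lineAbscissa (side P i) (h i) t - lineAbscissa (side P j) (h j) t := by
  have hs := slice_subset hM ei ej t
  obtain ⟨x, hx⟩ := hne
  have hx' := hs hx
  refine (ENNReal.toReal_mono (by simp) (measure_mono hs)).trans ?_
  rw [Real.volume_Icc, ENNReal.toReal_ofReal (by linarith [hx'.1, hx'.2])]

end Polygon

lemma exists_mem_slice {M : Set (ℝ × ℝ)} (hM : Convex ℝ M) {a b : ℝ × ℝ} (ha : a ∈ M) (hb : b ∈ M)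
    {t : ℝ} (hat : a.2 ≤ t) (htb : t ≤ b.2) : ∃ x, (x, t) ∈ M := by
  have hc : Convex ℝ (Prod.snd '' M) := hM.linear_image (LinearMap.snd ℝ ℝ ℝ)
  obtain ⟨⟨x, s⟩, hx, rfl⟩ := hc.ordConnected.out ⟨a, ha, rfl⟩ ⟨b, hb, rfl⟩ ⟨hat, htb⟩
  exact ⟨x, hx⟩

section Polygon

variable {n : ℕ} {P : Polygon (ℝ × ℝ) n}

/-- Both sides are the integral of `x dy` along the side, so a horizontal side gives zero. -/
lemma sideLevel_add_eq (i : Fin n) :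
    sideLevel P i + (side P i).1 * (((P i).2 + (P (finRotate n i)).2) / 2) =
      (side P i).2 * (((P i).1 + (P (finRotate n i)).1) / 2) := by
  simp only [sideLevel, bracket, side, Prod.fst_sub, Prod.snd_sub]
  ring

/-- Discrete integration by parts: each combined summand is the increment of the product of
coordinates along a side, so the sum telescopes cyclically. -/
lemma sum_sideLevel_add_sum :
    ∑ i, sideLevel P i + 2 * ∑ i, (side P i).1 * (((P i).2 + (P (finRotate n i)).2) / 2) = 0 := by
  have h := Equiv.sum_comp (finRotate n) (fun i => (P i).1 * (P i).2)
  rw [← sub_eq_zero, ← Finset.sum_sub_distrib] at h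
  rw [Finset.mul_sum, ← Finset.sum_add_distrib, ← h]
  refine Finset.sum_congr rfl fun i _ => ?_
  simp only [sideLevel, bracket, side, Prod.fst_sub, Prod.snd_sub]
  ring

lemma isCompact_region : IsCompact (region P) := (finite_range P.vertices).isCompact_convexHull ℝ

lemma ae_notMem_heights (P : Polygon (ℝ × ℝ) n) : ∀ᵐ t : ℝ, ∀ i, (P i).2 ≠ t := by
  refine ae_all_iff.2 fun i => ?_
  have : ∀ᵐ t : ℝ, t ≠ (P i).2 := Measure.ae_ne volume _
  filter_upwards [this] with t ht using ht.symm

namespace IsConvexPolygon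

/-- Vertex heights are excluded because a horizontal bottom side has positive length while the bound
vanishes there. -/
lemma sliceLength_region (hP : IsConvexPolygon P) {t : ℝ} (ht : ∀ i, (P i).2 ≠ t) :
    sliceLength (region P) t = sliceBound P (sideLevel P) t := by
  by_cases h : (∀ i, t ≤ (P i).2) ∨ ∀ i, (P i).2 < t
  · rw [sliceBound_eq_zero h, sliceLength]
    suffices (fun x : ℝ => (x, t)) ⁻¹' region P = ∅ by simp [this]
    rw [eq_empty_iff_forall_notMem]
    intro x hx
    have hlin : IsLinearMap ℝ (Prod.snd : ℝ × ℝ → ℝ) := (LinearMap.snd ℝ ℝ ℝ).isLinear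
    rcases h with h | h
    · have : region P ⊆ {x | t < x.2} := convexHull_min
        (by rintro _ ⟨i, rfl⟩; exact lt_of_le_of_ne (h i) (ht i).symm)
        (convex_halfSpace_gt hlin t)
      exact lt_irrefl t (this hx)
    · have : region P ⊆ {x | x.2 < t} := convexHull_min
        (by rintro _ ⟨i, rfl⟩; exact h i) (convex_halfSpace_lt hlin t)
      exact lt_irrefl t (this hx)
  · obtain ⟨i, j, hi, hj⟩ := exists_up_down h
    have ei : 0 < (side P i).2 := by rw [side_snd]; linarith
    have ej : (side P j).2 < 0 := by rw [side_snd]; linarith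
    have mi := lineAbscissa_mem_region_of_up ei hi.1.le hi.2
    have mj := lineAbscissa_mem_region_of_down ej hj.2 hj.1.le
    have hs : (fun x : ℝ => (x, t)) ⁻¹' region P =
        Icc (lineAbscissa (side P j) (sideLevel P j) t)
          (lineAbscissa (side P i) (sideLevel P i) t) := by
      refine (slice_subset (fun x hx k => hP.bracket_le_of_mem_region k hx) ei ej t).antisymm ?_
      have hc : Convex ℝ ((fun x : ℝ => (x, t)) ⁻¹' region P) := by
        intro x hx y hy a b ha hb hab
        have := (convex_convexHull ℝ (range P.vertices)) hx hy ha hb hab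
        simpa [region, ← add_mul, hab] using this
      exact hc.ordConnected.out mj mi
    have hle := (le_lineAbscissa_iff ei).2 (hP.bracket_le_of_mem_region i mj)
    rw [hP.sliceBound_eq _ hi hj, sliceLength, hs, Real.volume_Icc,
      ENNReal.toReal_ofReal (sub_nonneg.2 hle)]

lemma area_region (hP : IsConvexPolygon P) : area (region P) =
    ∑ i, (sideLevel P i + (side P i).1 * (((P i).2 + (P (finRotate n i)).2) / 2)) := by
  rw [← integral_sliceLength isCompact_region.measurableSet isCompact_region.measure_ne_top,
    integral_congr_ae (g := sliceBound P (sideLevel P)), integral_sliceBound]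
  · refine Finset.sum_congr rfl fun i _ => ?_
    split_ifs with he
    · rw [sideLevel_add_eq, he, zero_mul]
    · rfl
  · filter_upwards [ae_notMem_heights P] with t ht using hP.sliceLength_region ht

lemma sum_sideLevel (hP : IsConvexPolygon P) : ∑ i, sideLevel P i = 2 * area (region P) := by
  have h1 := hP.area_region
  have h2 := sum_sideLevel_add_sum (P := P)
  rw [Finset.sum_add_distrib] at h1
  linarith

end IsConvexPolygon

/-! ### The mixed-area inequality for sets of equal vertical extent -/

/-- `M` is a compact convex set of the same vertical extent as `P`, contained in the half-planes
`[x, e_i] ≤ h_i`, where the `e_i` are the sides of `P`. -/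
structure IsMatched (P : Polygon (ℝ × ℝ) n) (M : Set (ℝ × ℝ)) (h : Fin n → ℝ) : Prop where
  convex : Convex ℝ M
  isCompact : IsCompact M
  bracket_le : ∀ x ∈ M, ∀ i, bracket x (side P i) ≤ h i
  exists_height : ∀ i, ∃ m ∈ M, m.2 = (P i).2
  height_mem : ∀ m ∈ M, ∃ i j, (P i).2 ≤ m.2 ∧ m.2 ≤ (P j).2

namespace IsMatched

variable {M : Set (ℝ × ℝ)} {h : Fin n → ℝ}

lemma exists_mem_slice (hM : IsMatched P M h) {i j : Fin n} {t : ℝ} (hi : (P i).2 ≤ t)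
    (hj : t ≤ (P j).2) : ∃ x, (x, t) ∈ M := by
  obtain ⟨a, ha, hai⟩ := hM.exists_height i
  obtain ⟨b, hb, hbj⟩ := hM.exists_height j
  exact NormedPlane.exists_mem_slice hM.convex ha hb (hai ▸ hi) (hbj ▸ hj)

lemma sliceLength_le (hP : IsConvexPolygon P) (hM : IsMatched P M h) {t : ℝ}
    (ht : ∀ i, (P i).2 ≠ t) : sliceLength M t ≤ sliceBound P h t := by
  by_cases h' : (∀ i, t ≤ (P i).2) ∨ ∀ i, (P i).2 < t
  · rw [sliceBound_eq_zero h', sliceLength]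
    suffices (fun x : ℝ => (x, t)) ⁻¹' M = ∅ by simp [this]
    rw [eq_empty_iff_forall_notMem]
    intro x hx
    obtain ⟨i, j, hi, hj⟩ := hM.height_mem _ hx
    rcases h' with h' | h'
    · exact ht i (hi.antisymm (h' i))
    · exact (h' j).not_ge hj
  · obtain ⟨i, j, hi, hj⟩ := exists_up_down h'
    rw [hP.sliceBound_eq _ hi hj]
    exact sliceLength_le_sub hM.bracket_le (hM.exists_mem_slice hi.1.le hi.2)
      (by rw [side_snd]; linarith) (by rw [side_snd]; linarith)

lemma integral_sliceLength (hM : IsMatched P M h) : ∫ t, sliceLength M t = area M :=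
  NormedPlane.integral_sliceLength hM.isCompact.measurableSet hM.isCompact.measure_ne_top

lemma integrable_sliceLength (hM : IsMatched P M h) : Integrable (sliceLength M) :=
  NormedPlane.integrable_sliceLength hM.isCompact.measurableSet hM.isCompact.measure_ne_top

lemma ae_sliceLength_le (hP : IsConvexPolygon P) (hM : IsMatched P M h) :
    sliceLength M ≤ᵐ[volume] sliceBound P h := by
  filter_upwards [ae_notMem_heights P] with t ht using hM.sliceLength_le hP ht

lemma area_le_integral (hP : IsConvexPolygon P) (hM : IsMatched P M h) :
    area M ≤ ∫ t, sliceBound P h t := by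
  rw [← hM.integral_sliceLength]
  exact integral_mono_ae hM.integrable_sliceLength (integrable_sliceBound P h)
    (hM.ae_sliceLength_le hP)

/-- The term dropped for a horizontal side is nonnegative, since `M` has a point at the height of
that side and this point satisfies the `i`-th inequality. -/
lemma summand_le (hM : IsMatched P M h) (i : Fin n) :
    (if (side P i).2 = 0 then 0 else
      h i + (side P i).1 * (((P i).2 + (P (finRotate n i)).2) / 2)) ≤
      h i + (side P i).1 * (((P i).2 + (P (finRotate n i)).2) / 2) := by
  split_ifs with he
  · obtain ⟨m, hm, hmi⟩ := hM.exists_height i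
    have := hM.bracket_le m hm i
    rw [bracket, he, hmi] at this
    rw [side_snd, sub_eq_zero] at he
    rw [he]
    linarith
  · exact le_rfl

lemma sum_eq_sub_area (hP : IsConvexPolygon P) (h : Fin n → ℝ) :
    ∑ i, (h i + (side P i).1 * (((P i).2 + (P (finRotate n i)).2) / 2)) =
      ∑ i, h i - area (region P) := by
  have h1 := hP.sum_sideLevel
  have h2 := sum_sideLevel_add_sum (P := P)
  rw [Finset.sum_add_distrib]
  linarith

lemma integral_le (hP : IsConvexPolygon P) (hM : IsMatched P M h) :
    ∫ t, sliceBound P h t ≤ ∑ i, h i - area (region P) := by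
  rw [integral_sliceBound, ← sum_eq_sub_area hP]
  exact Finset.sum_le_sum fun i _ => hM.summand_le i

/-- When the `h i` are the support values of `M`, the right-hand side is twice the mixed area of the
polygon and `M`. -/
theorem area_add_area_le (hP : IsConvexPolygon P) (hM : IsMatched P M h) :
    area (region P) + area M ≤ ∑ i, h i := by
  linarith [hM.area_le_integral hP, hM.integral_le hP]

end IsMatched

end Polygon

/-! ### Equality in the mixed-area inequality -/

/-- A compact set of reals inside `[a, b]` whose measure is at least `b - a` contains the ends. -/
lemma endpoints_mem_of_le_volume {S : Set ℝ} {a b : ℝ} (hS : IsCompact S) (hne : S.Nonempty)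
    (hab : S ⊆ Icc a b) (hv : b - a ≤ (volume S).toReal) : a ∈ S ∧ b ∈ S := by
  obtain ⟨l, hl, hl'⟩ := hS.exists_isLeast hne
  obtain ⟨u, hu, hu'⟩ := hS.exists_isGreatest hne
  have hlu : l ≤ u := hl' hu
  have h1 : (volume S).toReal ≤ u - l := by
    refine (ENNReal.toReal_mono (by simp) (measure_mono
      (show S ⊆ Icc l u from fun x hx => ⟨hl' hx, hu' hx⟩))).trans ?_
    rw [Real.volume_Icc, ENNReal.toReal_ofReal (by linarith)]
  have h2 := (hab hl).1
  have h3 := (hab hu).2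
  exact ⟨(show a = l by linarith) ▸ hl, (show b = u by linarith) ▸ hu⟩

/-- A function on intervals that agrees on intersecting intervals takes everywhere the value at an
interval with the highest end, if every other upper end is contained in a higher interval. -/
lemma eq_of_agree_on_overlaps {ι : Type*} [Finite ι] {S : ι → Prop} {l u α : ι → ℝ} {T : ι}
    (hlu : ∀ i, S i → l i ≤ u i) (hT : S T) (hmax : ∀ i, S i → u i ≤ u T)
    (hcov : ∀ i, S i → u i < u T → ∃ k, S k ∧ l k ≤ u i ∧ u i < u k)
    (hagree : ∀ i j t, S i → S j → t ∈ Icc (l i) (u i) → t ∈ Icc (l j) (u j) → α i = α j)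
    {i : ι} (hi : S i) : α i = α T := by
  by_contra hne
  obtain ⟨m, ⟨hm, hmT⟩, hmm⟩ := (Set.toFinite {i | S i ∧ α i ≠ α T}).exists_maximalFor u _
    ⟨i, hi, hne⟩
  rcases (hmax m hm).lt_or_eq with hlt | heq
  · obtain ⟨k, hk, hk1, hk2⟩ := hcov m hm hlt
    have hmk := hagree m k (u m) hm hk ⟨hlu m hm, le_rfl⟩ ⟨hk1, hk2.le⟩
    have := hmm (j := k) ⟨hk, hmk ▸ hmT⟩ hk2.le
    exact absurd hk2 this.not_gt
  · exact hmT (hagree m T (u m) hm hT ⟨hlu m hm, le_rfl⟩ ⟨heq ▸ hlu T hT, heq.le⟩)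

section Polygon

variable {n : ℕ} {P : Polygon (ℝ × ℝ) n}

lemma exists_up_side' {a b : Fin n} {t : ℝ} (ha : (P a).2 ≤ t) (hb : t < (P b).2) :
    ∃ i, (P i).2 ≤ t ∧ t < (P (finRotate n i)).2 := by
  by_contra! h
  exact (finRotate_induction (S := fun i => (P i).2 ≤ t) h ha b).not_gt hb

lemma exists_down_side' {a b : Fin n} {t : ℝ} (ha : (P a).2 ≤ t) (hb : t < (P b).2) :
    ∃ i, (P (finRotate n i)).2 ≤ t ∧ t < (P i).2 := by
  by_contra! h
  refine (finRotate_induction (S := fun i => t < (P i).2) (fun i hi => ?_) hb a).not_ge ha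
  by_contra! h'
  exact (h i h').not_gt hi

lemma lineAbscissa_sub {e : ℝ × ℝ} (h h' t : ℝ) :
    lineAbscissa e h t - lineAbscissa e h' t = (h - h') / e.2 := by
  rw [lineAbscissa, lineAbscissa]
  ring

lemma up_iff {i : Fin n} : 0 < (side P i).2 ↔ (P i).2 < (P (finRotate n i)).2 := by
  rw [side_snd, sub_pos]

lemma down_iff {i : Fin n} : (side P i).2 < 0 ↔ (P (finRotate n i)).2 < (P i).2 := by
  rw [side_snd, sub_neg]

/-- If consecutive sides were parallel, `P i` would lie on the line of the next side and so `i`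
would index one of its ends. Then `{i, finRotate n i}` is closed under rotation, against `3 ≤ n`. -/
lemma IsConvexPolygon.bracket_next_side_ne_zero (hP : IsConvexPolygon P) (i : Fin n) :
    bracket (side P (finRotate n i)) (side P i) ≠ 0 := by
  intro h
  have h0 : bracket (side P (finRotate n i)) (P i - P (finRotate n i)) = 0 := by
    rw [← neg_sub, ← side, ← neg_eq_zero, ← h]
    simp only [bracket, Prod.fst_neg, Prod.snd_neg]
    ring
  have hall : ∀ j, j ∈ ({i, finRotate n i} : Finset (Fin n)) := by
    refine fun j => finRotate_induction (S := fun j => j ∈ ({i, finRotate n i} : Finset (Fin n)))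
      (a := i) (fun k hk => ?_) (by simp) j
    simp only [Finset.mem_insert, Finset.mem_singleton] at hk ⊢
    rcases hk with rfl | rfl
    · exact Or.inr rfl
    · rcases hP.eq_or_eq_of_bracket_eq_zero h0 with h1 | h1
      · right
        rw [← h1]
        exact h1.symm
      · exact Or.inl h1.symm
  have hcard : (Finset.univ : Finset (Fin n)).card ≤ 2 :=
    (Finset.card_le_card fun j _ => hall j).trans Finset.card_le_two
  rw [Finset.card_univ, Fintype.card_fin] at hcard
  have := hP.1
  omega

lemma IsConvexPolygon.side_snd_ne_zero_of_next (hP : IsConvexPolygon P) {i : Fin n}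
    (h : (side P (finRotate n i)).2 = 0) : (side P i).2 ≠ 0 := fun hi =>
  hP.bracket_next_side_ne_zero i (by rw [bracket, h, hi]; ring)

lemma IsConvexPolygon.exists_heights_lt (hP : IsConvexPolygon P) : ∃ a b, (P a).2 < (P b).2 := by
  have i : Fin n := ⟨0, by have := hP.1; omega⟩
  by_cases h : (side P (finRotate n i)).2 = 0
  · have := hP.side_snd_ne_zero_of_next h
    rcases this.lt_or_gt with h | h
    · exact ⟨_, _, down_iff.1 h⟩
    · exact ⟨_, _, up_iff.1 h⟩
  · rcases Ne.lt_or_gt h with h | h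
    · exact ⟨_, _, down_iff.1 h⟩
    · exact ⟨_, _, up_iff.1 h⟩

namespace IsMatched

variable {M : Set (ℝ × ℝ)} {h : Fin n → ℝ}

lemma isCompact_slice (hM : IsMatched P M h) (t : ℝ) :
    IsCompact ((fun x : ℝ => (x, t)) ⁻¹' M) := by
  have : (fun x : ℝ => (x, t)) ⁻¹' M = Prod.fst '' (M ∩ {q | q.2 = t}) := by
    ext x
    constructor
    · exact fun hx => ⟨(x, t), ⟨hx, rfl⟩, rfl⟩
    · rintro ⟨⟨y, s⟩, ⟨hq, rfl⟩, rfl⟩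
      exact hq
  rw [this]
  exact (hM.isCompact.inter_right (isClosed_eq continuous_snd continuous_const)).image
    continuous_fst

lemma lineAbscissa_mem_of_eq (hP : IsConvexPolygon P) (hM : IsMatched P M h) {i j : Fin n} {t : ℝ}
    (ht : sliceLength M t = sliceBound P h t)
    (hi : (P i).2 < t ∧ t ≤ (P (finRotate n i)).2)
    (hj : (P (finRotate n j)).2 < t ∧ t ≤ (P j).2) :
    (lineAbscissa (side P j) (h j) t, t) ∈ M ∧ (lineAbscissa (side P i) (h i) t, t) ∈ M := by
  have ei : 0 < (side P i).2 := by rw [side_snd]; linarith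
  have ej : (side P j).2 < 0 := by rw [side_snd]; linarith
  rw [hP.sliceBound_eq _ hi hj] at ht
  exact endpoints_mem_of_le_volume (hM.isCompact_slice t) (hM.exists_mem_slice hi.1.le hi.2)
    (slice_subset hM.bracket_le ei ej t) ht.ge

/-- A set of full measure is dense and `M` is closed. -/
lemma mem_of_ae_mem (hM : IsMatched P M h) {e : ℝ × ℝ} {c a b : ℝ} (hab : a < b)
    (hae : ∀ᵐ t : ℝ, t ∈ Ioo a b → (lineAbscissa e c t, t) ∈ M) {t : ℝ} (ht : t ∈ Icc a b) :
    (lineAbscissa e c t, t) ∈ M := by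
  have hcont : Continuous fun t : ℝ => (lineAbscissa e c t, t) := by
    unfold lineAbscissa
    fun_prop
  have hcl : IsClosed {t : ℝ | (lineAbscissa e c t, t) ∈ M} :=
    hM.isCompact.isClosed.preimage hcont
  have hd : Dense {t : ℝ | t ∈ Ioo a b → (lineAbscissa e c t, t) ∈ M} :=
    Measure.dense_of_ae hae
  rw [← closure_Ioo hab.ne] at ht
  refine closure_minimal ?_ hcl (closure_minimal
    (hd.open_subset_closure_inter isOpen_Ioo) isClosed_closure ht)
  exact fun s hs => hs.2 hs.1

variable (hP : IsConvexPolygon P) (hM : IsMatched P M h)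
  (hh : area (region P) + area M = ∑ i, h i)
include hP hM hh

lemma ae_sliceLength_eq : sliceLength M =ᵐ[volume] sliceBound P h := by
  refine (integral_eq_iff_of_ae_le hM.integrable_sliceLength (integrable_sliceBound P h)
    (hM.ae_sliceLength_le hP)).1 ?_
  rw [hM.integral_sliceLength]
  exact le_antisymm (hM.area_le_integral hP) (by linarith [hM.integral_le hP])

lemma level_eq_of_horizontal {i : Fin n} (hi : (side P i).2 = 0) : h i = sideLevel P i := by
  have h1 : ∫ t, sliceBound P h t = ∑ i, h i - area (region P) :=
    le_antisymm (hM.integral_le hP) (by linarith [hM.area_le_integral hP])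
  rw [integral_sliceBound, ← sum_eq_sub_area hP,
    Finset.sum_eq_sum_iff_of_le fun i _ => hM.summand_le i] at h1
  have h2 := h1 i (Finset.mem_univ i)
  have h3 := sideLevel_add_eq (P := P) i
  rw [if_pos hi] at h2
  rw [hi] at h3
  linarith

lemma lineAbscissa_mem_of_up {i : Fin n} (hi : 0 < (side P i).2) {t : ℝ}
    (ht : t ∈ Icc (P i).2 (P (finRotate n i)).2) :
    (lineAbscissa (side P i) (h i) t, t) ∈ M := by
  refine hM.mem_of_ae_mem (up_iff.1 hi) ?_ ht
  filter_upwards [hM.ae_sliceLength_eq hP hh] with t ht hti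
  obtain ⟨j, hj⟩ := exists_down_side hti.1 hti.2.le
  exact (hM.lineAbscissa_mem_of_eq hP ht ⟨hti.1, hti.2.le⟩ hj).2

lemma lineAbscissa_mem_of_down {j : Fin n} (hj : (side P j).2 < 0) {t : ℝ}
    (ht : t ∈ Icc (P (finRotate n j)).2 (P j).2) :
    (lineAbscissa (side P j) (h j) t, t) ∈ M := by
  refine hM.mem_of_ae_mem (down_iff.1 hj) ?_ ht
  filter_upwards [hM.ae_sliceLength_eq hP hh] with t ht htj
  obtain ⟨i, hi⟩ := exists_up_side htj.1 htj.2.le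
  exact (hM.lineAbscissa_mem_of_eq hP ht hi ⟨htj.1, htj.2.le⟩).1

/-- The points of both lines `[x, e] = h` at height `t` lie in `M`, so each obeys the other
inequality and they coincide, as do the points of the original side lines. Subtract. -/
lemma shift_eq_of_up {i j : Fin n} {t : ℝ} (hi : 0 < (side P i).2) (hj : 0 < (side P j).2)
    (hti : t ∈ Icc (P i).2 (P (finRotate n i)).2) (htj : t ∈ Icc (P j).2 (P (finRotate n j)).2) :
    (h i - sideLevel P i) / (side P i).2 = (h j - sideLevel P j) / (side P j).2 := by
  have h1 := (le_lineAbscissa_iff hj).2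
    (hM.bracket_le _ (hM.lineAbscissa_mem_of_up hP hh hi hti) j)
  have h2 := (le_lineAbscissa_iff hi).2
    (hM.bracket_le _ (hM.lineAbscissa_mem_of_up hP hh hj htj) i)
  have h3 := hP.lineAbscissa_eq_of_up hi hj hti htj
  rw [← lineAbscissa_sub _ _ t, ← lineAbscissa_sub _ _ t, h3, h1.antisymm h2]

lemma shift_eq_of_down {i j : Fin n} {t : ℝ} (hi : (side P i).2 < 0) (hj : (side P j).2 < 0)
    (hti : t ∈ Icc (P (finRotate n i)).2 (P i).2) (htj : t ∈ Icc (P (finRotate n j)).2 (P j).2) :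
    (h i - sideLevel P i) / (side P i).2 = (h j - sideLevel P j) / (side P j).2 := by
  have h1 := (lineAbscissa_le_iff hj).2
    (hM.bracket_le _ (hM.lineAbscissa_mem_of_down hP hh hi hti) j)
  have h2 := (lineAbscissa_le_iff hi).2
    (hM.bracket_le _ (hM.lineAbscissa_mem_of_down hP hh hj htj) i)
  have h3 := hP.lineAbscissa_eq_of_down hi hj hti htj
  rw [← lineAbscissa_sub _ _ t, ← lineAbscissa_sub _ _ t, h3, h2.antisymm h1]

/-- The closed height intervals of rising sides overlap up to the top of the polygon, so the local
agreement of shifts propagates to a side `T` that reaches the top. -/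
lemma exists_shift_up : ∃ α, ∀ i, 0 < (side P i).2 →
    (h i - sideLevel P i) / (side P i).2 = α := by
  obtain ⟨a, b, hab⟩ := hP.exists_heights_lt
  have : Nonempty (Fin n) := ⟨a⟩
  obtain ⟨m, hm⟩ := Finite.exists_max fun i => (P i).2
  obtain ⟨T, hT, hT'⟩ := exists_up_side (hab.trans_le (hm b)) le_rfl
  have hTm : (P (finRotate n T)).2 = (P m).2 := (hm _).antisymm hT'
  refine ⟨_, fun i hi => eq_of_agree_on_overlaps (S := fun i => 0 < (side P i).2)
    (l := fun i => (P i).2) (u := fun i => (P (finRotate n i)).2)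
    (α := fun i => (h i - sideLevel P i) / (side P i).2) (T := T)
    (fun i hi => (up_iff.1 hi).le) (up_iff.2 (hTm ▸ hT)) (fun i _ => (hm _).trans hT')
    (fun i hi hlt => ?_) (fun i j t hi hj hti htj => hM.shift_eq_of_up hP hh hi hj hti htj) hi⟩
  obtain ⟨k, hk⟩ := exists_up_side' (up_iff.1 hi).le hlt
  have hik : (P i).2 < (P (finRotate n i)).2 := up_iff.1 hi
  exact ⟨k, up_iff.2 (hk.1.trans_lt hk.2), hk⟩

lemma exists_shift_down : ∃ β, ∀ i, (side P i).2 < 0 →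
    (h i - sideLevel P i) / (side P i).2 = β := by
  obtain ⟨a, b, hab⟩ := hP.exists_heights_lt
  have : Nonempty (Fin n) := ⟨a⟩
  obtain ⟨m, hm⟩ := Finite.exists_max fun i => (P i).2
  obtain ⟨T, hT, hT'⟩ := exists_down_side (hab.trans_le (hm b)) le_rfl
  have hTm : (P T).2 = (P m).2 := (hm _).antisymm hT'
  refine ⟨_, fun i hi => eq_of_agree_on_overlaps (S := fun i => (side P i).2 < 0)
    (l := fun i => (P (finRotate n i)).2) (u := fun i => (P i).2)
    (α := fun i => (h i - sideLevel P i) / (side P i).2) (T := T)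
    (fun i hi => (down_iff.1 hi).le) (down_iff.2 (hTm ▸ hT)) (fun i _ => (hm _).trans hT')
    (fun i hi hlt => ?_) (fun i j t hi hj hti htj => hM.shift_eq_of_down hP hh hi hj hti htj) hi⟩
  obtain ⟨k, hk⟩ := exists_down_side' (down_iff.1 hi).le hlt
  exact ⟨k, down_iff.2 (hk.1.trans_lt hk.2), hk⟩

/-- In the equality case, if the areas agree too, then the lines `[x, e_i] = h_i` are obtained
from the side lines of the polygon by one horizontal translation. -/
lemma exists_shift (ha : area M = area (region P)) :
    ∃ α, ∀ i, h i - sideLevel P i = α * (side P i).2 := by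
  obtain ⟨α, hα⟩ := hM.exists_shift_up hP hh
  obtain ⟨β, hβ⟩ := hM.exists_shift_down hP hh
  -- One formula for falling, horizontal and rising sides, chosen so that the `β` term cancels on
  -- summation.
  have key : ∀ i, h i - sideLevel P i = β * (side P i).2 + (α - β) * max (side P i).2 0 := by
    intro i
    rcases lt_trichotomy (side P i).2 0 with hi | hi | hi
    · rw [max_eq_right hi.le, ← hβ i hi, div_mul_cancel₀ _ hi.ne]
      ring
    · rw [hi, hM.level_eq_of_horizontal hP hh hi]
      simp
    · have := hα i hi
      rw [div_eq_iff hi.ne'] at this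
      rw [max_eq_left hi.le, this]
      ring
  have hsum := Finset.sum_congr (rfl : (Finset.univ : Finset (Fin n)) = Finset.univ)
    fun i _ => key i
  have hz : ∑ i, (side P i).2 = 0 := by
    have := congrArg Prod.snd (sum_side (P := P))
    rwa [Prod.snd_sum] at this
  -- With equal areas both `∑ h i` and `∑ sideLevel P i` are twice the area, so the left side
  -- becomes zero.
  rw [Finset.sum_sub_distrib, Finset.sum_add_distrib, ← Finset.mul_sum, ← Finset.mul_sum, hz,
    hP.sum_sideLevel, ← hh, ha] at hsum
  obtain ⟨a, b, hab⟩ := hP.exists_heights_lt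
  obtain ⟨T, hT, hT'⟩ := exists_up_side hab le_rfl
  have hpos : 0 < ∑ i, max (side P i).2 0 :=
    Finset.sum_pos' (fun i _ => le_max_right _ _)
      ⟨T, Finset.mem_univ T, lt_max_of_lt_left (up_iff.2 (hT.trans_le hT'))⟩
  have hαβ : α - β = 0 := (mul_eq_zero.1 (by linarith : (α - β) * _ = 0)).resolve_right hpos.ne'
  refine ⟨β, fun i => ?_⟩
  rw [key, hαβ, zero_mul, add_zero]

theorem exists_translate_subset (ha : area M = area (region P)) :
    ∃ z : ℝ × ℝ, z +ᵥ region P ⊆ M := by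
  obtain ⟨α, hα⟩ := hM.exists_shift hP hh ha
  have hx : ∀ i, (side P i).2 ≠ 0 → ∀ t, lineAbscissa (side P i) (h i) t =
      α + lineAbscissa (side P i) (sideLevel P i) t := by
    intro i hi t
    have := lineAbscissa_sub (e := side P i) (h i) (sideLevel P i) t
    rw [hα, mul_div_cancel_right₀ _ hi] at this
    linarith
  have hl : ∀ i, (side P i).2 ≠ 0 → ((α, 0) : ℝ × ℝ) + P i ∈ M ∧
      ((α, 0) : ℝ × ℝ) + P (finRotate n i) ∈ M := by
    intro i hi
    have e1 : ((α, 0) : ℝ × ℝ) + P i = (lineAbscissa (side P i) (h i) (P i).2, (P i).2) := by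
      rw [hx i hi, lineAbscissa_sideLevel_left hi]
      ext <;> simp
    have e2 : ((α, 0) : ℝ × ℝ) + P (finRotate n i) =
        (lineAbscissa (side P i) (h i) (P (finRotate n i)).2, (P (finRotate n i)).2) := by
      rw [hx i hi, lineAbscissa_sideLevel_right hi]
      ext <;> simp
    rw [e1, e2]
    rcases hi.lt_or_gt with hi | hi
    · have := (down_iff.1 hi).le
      exact ⟨hM.lineAbscissa_mem_of_down hP hh hi ⟨this, le_rfl⟩,
        hM.lineAbscissa_mem_of_down hP hh hi ⟨le_rfl, this⟩⟩
    · have := (up_iff.1 hi).le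
      exact ⟨hM.lineAbscissa_mem_of_up hP hh hi ⟨le_rfl, this⟩,
        hM.lineAbscissa_mem_of_up hP hh hi ⟨this, le_rfl⟩⟩
  -- The start of a horizontal side is the end of the preceding side, which is not horizontal.
  have hv : ∀ i, ((α, 0) : ℝ × ℝ) + P i ∈ M := by
    intro i
    obtain ⟨k, rfl⟩ := (finRotate n).surjective i
    by_cases hk : (side P (finRotate n k)).2 = 0
    · exact (hl k (hP.side_snd_ne_zero_of_next hk)).2
    · exact (hl _ hk).1
  refine ⟨(α, 0), ?_⟩
  have : region P ⊆ (fun x => ((α, 0) : ℝ × ℝ) + x) ⁻¹' M := by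
    refine convexHull_min ?_ (hM.convex.translate_preimage_right _)
    rintro _ ⟨i, rfl⟩
    exact hv i
  rintro _ ⟨x, hx, rfl⟩
  exact this hx

end IsMatched

end Polygon

/-! ### Homotheties, the unit ball and the symmetrization -/

lemma bracket_neg_left (x e : ℝ × ℝ) : bracket (-x) e = -bracket x e := by
  simp only [bracket, Prod.fst_neg, Prod.snd_neg]
  ring

lemma bracket_vadd_smul (x y e : ℝ × ℝ) (c : ℝ) :
    bracket (x +ᵥ c • y) e = bracket x e + c * bracket y e := by
  simp only [bracket, vadd_eq_add, Prod.fst_add, Prod.snd_add, Prod.smul_fst, Prod.smul_snd,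
    smul_eq_mul]
  ring

lemma continuous_bracket (e : ℝ × ℝ) : Continuous fun x => bracket x e := by
  unfold bracket
  fun_prop

lemma area_vadd_smul (x : ℝ × ℝ) (c : ℝ) (S : Set (ℝ × ℝ)) :
    area (x +ᵥ c • S) = c ^ 2 * area S := by
  have : Module.finrank ℝ (ℝ × ℝ) = 2 := by simp
  rw [area, measure_vadd, Measure.addHaar_smul, this, ENNReal.toReal_mul,
    ENNReal.toReal_ofReal (abs_nonneg _), abs_of_nonneg (sq_nonneg c), area]

/-- A closed subset of a compact convex body with the same area is the whole body. -/
lemma eq_of_subset_of_area_eq {A B : Set (ℝ × ℝ)} (hA : IsClosed A) (hB : IsCompact B)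
    (hc : Convex ℝ B) (hi : (interior B).Nonempty) (hAB : A ⊆ B) (h : area A = area B) :
    A = B := by
  have hfA : volume A ≠ ⊤ := ((measure_mono hAB).trans_lt hB.measure_lt_top).ne
  have hv : volume A = volume B := (ENNReal.toReal_eq_toReal_iff' hfA hB.measure_ne_top).1 h
  have hd : volume (interior B \ A) = 0 := by
    refine measure_mono_null (sdiff_subset_sdiff_left interior_subset) ?_
    rw [measure_sdiff hAB hA.measurableSet.nullMeasurableSet hfA, hv, tsub_self]
  have he : interior B \ A = ∅ := ((isOpen_interior.sdiff hA).measure_eq_zero_iff volume).1 hd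
  refine hAB.antisymm ?_
  calc B ⊆ closure B := subset_closure
    _ = closure (interior B) := (hc.closure_interior_eq_closure_of_nonempty_interior hi).symm
    _ ⊆ A := closure_minimal (sdiff_eq_empty.1 he) hA

namespace IsUnitBall

variable {U : Set (ℝ × ℝ)}

lemma sSup_bracket (hU : IsUnitBall U) (e : ℝ × ℝ) :
    sSup ((fun u => bracket u e) '' U) = dualNorm U e := by
  have hne : U.Nonempty := hU.interior_nonempty.mono interior_subset
  have hb1 : BddAbove ((fun u => bracket u e) '' U) :=
    (hU.isCompact.image (continuous_bracket e)).bddAbove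
  have hb2 : BddAbove ((fun u => |bracket u e|) '' U) :=
    (hU.isCompact.image (continuous_bracket e).abs).bddAbove
  refine le_antisymm (csSup_le (hne.image _) ?_) (csSup_le (hne.image _) ?_)
  · rintro _ ⟨u, hu, rfl⟩
    exact (le_abs_self _).trans (le_csSup hb2 ⟨u, hu, rfl⟩)
  · rintro _ ⟨u, hu, rfl⟩
    exact abs_le'.2 ⟨le_csSup hb1 ⟨u, hu, rfl⟩,
      bracket_neg_left u e ▸ le_csSup hb1 ⟨-u, hU.symmetric u hu, rfl⟩⟩

lemma abs_bracket_le (hU : IsUnitBall U) {u : ℝ × ℝ} (hu : u ∈ U) (e : ℝ × ℝ) :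
    |bracket u e| ≤ dualNorm U e :=
  le_csSup (hU.isCompact.image (continuous_bracket e).abs).bddAbove ⟨u, hu, rfl⟩

lemma exists_bracket_eq (hU : IsUnitBall U) (e : ℝ × ℝ) : ∃ u ∈ U, bracket u e = dualNorm U e := by
  rw [← hU.sSup_bracket]
  exact (hU.isCompact.image (continuous_bracket e)).sSup_mem
    ((hU.interior_nonempty.mono interior_subset).image _)

variable {n : ℕ} {P : Polygon (ℝ × ℝ) n}

lemma mem_symmCircumscribed (hU : IsUnitBall U) {x : ℝ × ℝ} :
    x ∈ symmCircumscribed U P ↔ ∀ i, |bracket x (side P i)| ≤ dualNorm U (side P i) := by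
  simp only [symmCircumscribed, circumscribed, supportHalfPlane, hU.sSup_bracket, mem_inter_iff,
    mem_iInter, mem_ofPred_eq, Set.mem_neg, bracket_neg_left, abs_le', forall_and]

lemma subset_symmCircumscribed (hU : IsUnitBall U) : U ⊆ symmCircumscribed U P := fun _ hu =>
  hU.mem_symmCircumscribed.2 fun i => hU.abs_bracket_le hu (side P i)

lemma neg_mem_symmCircumscribed (hU : IsUnitBall U) {x : ℝ × ℝ}
    (hx : x ∈ symmCircumscribed U P) : -x ∈ symmCircumscribed U P := by
  rw [hU.mem_symmCircumscribed] at hx ⊢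
  simpa only [bracket_neg_left, abs_neg] using hx

lemma interior_symmCircumscribed_nonempty (hU : IsUnitBall U) :
    (interior (symmCircumscribed U P)).Nonempty :=
  hU.interior_nonempty.mono (interior_mono hU.subset_symmCircumscribed)

lemma convex_symmCircumscribed : Convex ℝ (symmCircumscribed U P) := by
  have : Convex ℝ (circumscribed U P) := convex_iInter fun i => convex_bracket_le _ _
  exact this.inter this.neg

lemma isCompact_symmCircumscribed (hU : IsUnitBall U) (hP : IsConvexPolygon P) :
    IsCompact (symmCircumscribed U P) := by
  have i : Fin n := ⟨0, by have := hP.1; omega⟩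
  set e := side P i
  set f := side P (finRotate n i)
  have hD : bracket f e ≠ 0 := hP.bracket_next_side_ne_zero i
  have hcl : IsClosed (symmCircumscribed U P) := by
    have : symmCircumscribed U P =
        ⋂ i, {x | |bracket x (side P i)| ≤ dualNorm U (side P i)} := by
      ext x
      rw [hU.mem_symmCircumscribed, mem_iInter]
      rfl
    rw [this]
    exact isClosed_iInter fun i => isClosed_le (continuous_bracket _).abs continuous_const
  -- Cramer's rule recovers `x` from `[x, e]` and `[x, f]` for two consecutive sides, so the set
  -- lies in a compact parallelogram.
  let g : ℝ × ℝ → ℝ × ℝ := fun q =>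
    ((q.1 * f.1 - q.2 * e.1) / bracket f e, (q.1 * f.2 - q.2 * e.2) / bracket f e)
  have hg : Continuous g := by fun_prop
  refine (((isCompact_Icc (a := -dualNorm U e) (b := dualNorm U e)).prod
    (isCompact_Icc (a := -dualNorm U f) (b := dualNorm U f))).image hg).of_isClosed_subset hcl ?_
  intro x hx
  rw [hU.mem_symmCircumscribed] at hx
  refine ⟨(bracket x e, bracket x f), ⟨abs_le.1 (hx i), abs_le.1 (hx (finRotate n i))⟩, ?_⟩
  ext
  · rw [div_eq_iff hD]
    simp only [bracket]
    ring
  · rw [div_eq_iff hD]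
    simp only [bracket]
    ring

lemma area_symmCircumscribed_pos (hU : IsUnitBall U) (hP : IsConvexPolygon P) :
    0 < area (symmCircumscribed U P) :=
  ENNReal.toReal_pos (Measure.measure_pos_of_nonempty_interior volume
    hU.interior_symmCircumscribed_nonempty).ne' (hU.isCompact_symmCircumscribed hP).measure_ne_top

lemma exists_height_pos (hU : IsUnitBall U) (hP : IsConvexPolygon P) :
    ∃ m ∈ symmCircumscribed U P, 0 < m.2 ∧ ∀ x ∈ symmCircumscribed U P, |x.2| ≤ m.2 := by
  have hne := hU.interior_symmCircumscribed_nonempty (P := P)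
  obtain ⟨m, hm, hmax⟩ := (hU.isCompact_symmCircumscribed hP).exists_isMaxOn
    (hne.mono interior_subset) continuous_snd.continuousOn
  have habs : ∀ x ∈ symmCircumscribed U P, |x.2| ≤ m.2 := fun x hx =>
    abs_le'.2 ⟨hmax hx, hmax (hU.neg_mem_symmCircumscribed hx)⟩
  refine ⟨m, hm, lt_of_le_of_ne ((abs_nonneg _).trans (habs m hm)) fun h0 => ?_, habs⟩
  -- If the maximal height were zero, the open projection of the interior would lie in a single
  -- point.
  have hsub : Prod.snd '' interior (symmCircumscribed U P) ⊆ {(0 : ℝ)} := by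
    rintro _ ⟨x, hx, rfl⟩
    exact abs_nonpos_iff.1 (h0 ▸ habs x (interior_subset hx))
  have := interior_maximal hsub (isOpenMap_snd _ isOpen_interior)
  rw [interior_singleton] at this
  exact (hne.image Prod.snd).not_subset_empty this

/-- Some positive homothetic copy of the symmetrization has the vertical extent of `P`. -/
lemma exists_isMatched (hU : IsUnitBall U) (hP : IsConvexPolygon P) :
    ∃ (r : ℝ) (x : ℝ × ℝ), 0 < r ∧ IsMatched P (x +ᵥ r • symmCircumscribed U P)
      (fun i => bracket x (side P i) + r * dualNorm U (side P i)) := by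
  obtain ⟨m, hm, hm0, hmax⟩ := hU.exists_height_pos hP
  obtain ⟨a, b, hab⟩ := hP.exists_heights_lt
  have : Nonempty (Fin n) := ⟨a⟩
  obtain ⟨v, hv⟩ := Finite.exists_max fun i => (P i).2
  obtain ⟨w, hw⟩ := Finite.exists_min fun i => (P i).2
  have hwv : (P w).2 < (P v).2 := (hw a).trans_lt (hab.trans_le (hv b))
  -- The symmetrization extends over heights from `-m.2` to `m.2`; `r` is the ratio of the two
  -- vertical extents and `x` matches the mid-heights.
  set r := ((P v).2 - (P w).2) / (2 * m.2) with hr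
  have hr0 : 0 < r := div_pos (by linarith) (by linarith)
  have hrm : r * m.2 = ((P v).2 - (P w).2) / 2 := by
    rw [hr]
    field_simp
  set x : ℝ × ℝ := (0, ((P v).2 + (P w).2) / 2) with hx
  have hheight : ∀ y : ℝ × ℝ, (x +ᵥ r • y).2 = ((P v).2 + (P w).2) / 2 + r * y.2 := fun y => rfl
  have hmem : ∀ y ∈ symmCircumscribed U P, x +ᵥ r • y ∈ x +ᵥ r • symmCircumscribed U P :=
    fun y hy => vadd_mem_vadd_set (smul_mem_smul_set hy)
  have hconv : Convex ℝ (x +ᵥ r • symmCircumscribed U P) :=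
    (convex_symmCircumscribed.smul r).vadd x
  refine ⟨r, x, hr0, hconv, ((hU.isCompact_symmCircumscribed hP).smul r).vadd x, ?_, ?_, ?_⟩
  · rintro _ ⟨_, ⟨y, hy, rfl⟩, rfl⟩ i
    have := (le_abs_self _).trans (hU.mem_symmCircumscribed.1 hy i)
    have h2 := mul_le_mul_of_nonneg_left this hr0.le
    have h3 := bracket_vadd_smul x y (side P i) r
    show bracket (x +ᵥ r • y) (side P i) ≤ _
    linarith
  · intro i
    have hlow := hmem _ (hU.neg_mem_symmCircumscribed hm)
    obtain ⟨s, hs⟩ := exists_mem_slice hconv hlow (hmem _ hm) (t := (P i).2)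
      (by rw [hheight, Prod.snd_neg]; linarith [hw i]) (by rw [hheight]; linarith [hv i])
    exact ⟨_, hs, rfl⟩
  · rintro _ ⟨_, ⟨y, hy, rfl⟩, rfl⟩
    have h1 := abs_le.1 (hmax y hy)
    have h2 := mul_le_mul_of_nonneg_left h1.1 hr0.le
    have h3 := mul_le_mul_of_nonneg_left h1.2 hr0.le
    refine ⟨w, v, ?_, ?_⟩
    · show _ ≤ (x +ᵥ r • y).2
      rw [hheight]
      linarith
    · show (x +ᵥ r • y).2 ≤ _
      rw [hheight]
      linarith

lemma sum_bracket_add (x : ℝ × ℝ) (r : ℝ) :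
    ∑ i, (bracket x (side P i) + r * dualNorm U (side P i)) = r * dualLength U P := by
  have h0 : ∑ i, bracket x (side P i) = 0 := by
    have h1 := congrArg Prod.fst (sum_side (P := P))
    have h2 := congrArg Prod.snd (sum_side (P := P))
    rw [Prod.fst_sum] at h1
    rw [Prod.snd_sum] at h2
    simp only [bracket]
    rw [Finset.sum_sub_distrib, ← Finset.mul_sum, ← Finset.mul_sum, h1, h2]
    simp
  rw [Finset.sum_add_distrib, h0, zero_add, ← Finset.mul_sum, dualLength]

lemma four_mul_area_mul_area_le (hU : IsUnitBall U) (hP : IsConvexPolygon P) :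
    4 * area (region P) * area (symmCircumscribed U P) ≤ dualLength U P ^ 2 := by
  obtain ⟨r, x, hr, hM⟩ := hU.exists_isMatched hP
  have h := hM.area_add_area_le hP
  rw [area_vadd_smul, sum_bracket_add] at h
  set A := area (region P)
  set B := area (symmCircumscribed U P)
  have hA : 0 ≤ A := ENNReal.toReal_nonneg
  have hB : 0 ≤ B := ENNReal.toReal_nonneg
  have h2 : (A + r ^ 2 * B) ^ 2 ≤ (r * dualLength U P) ^ 2 :=
    pow_le_pow_left₀ (by positivity) h 2
  -- AM-GM applied to `A` and `r ^ 2 * B`.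
  have h3 : r ^ 2 * (4 * A * B) ≤ r ^ 2 * dualLength U P ^ 2 := by
    nlinarith [sq_nonneg (A - r ^ 2 * B)]
  exact le_of_mul_le_mul_left h3 (by positivity)

lemma exists_homothety_of_eq (hU : IsUnitBall U) (hP : IsConvexPolygon P)
    (heq : dualLength U P ^ 2 = 4 * area (region P) * area (symmCircumscribed U P)) :
    ∃ (c : ℝ) (x : ℝ × ℝ), 0 < c ∧ region P = x +ᵥ c • symmCircumscribed U P := by
  obtain ⟨r, x, hr, hM⟩ := hU.exists_isMatched hP
  have h := hM.area_add_area_le hP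
  have hM' := area_vadd_smul x r (symmCircumscribed U P)
  set M := x +ᵥ r • symmCircumscribed U P with hMdef
  set A := area (region P)
  have hA : 0 ≤ A := ENNReal.toReal_nonneg
  have hB : 0 ≤ area M := ENNReal.toReal_nonneg
  have hsum := sum_bracket_add (U := U) (P := P) x r
  have hL : (∑ i, (bracket x (side P i) + r * dualNorm U (side P i))) ^ 2 = 4 * A * area M := by
    rw [hsum, hM', mul_pow, heq]
    ring
  set L := ∑ i, (bracket x (side P i) + r * dualNorm U (side P i))
  have h2 : (A + area M) ^ 2 ≤ L ^ 2 := pow_le_pow_left₀ (by positivity) h 2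
  have hAM : area M = A := by
    have : (area M - A) ^ 2 = 0 := le_antisymm (by nlinarith) (sq_nonneg _)
    exact sub_eq_zero.1 (pow_eq_zero_iff two_ne_zero |>.1 this)
  have hLA : A + area M = L := by
    refine (pow_left_inj₀ (by positivity) ((by positivity : 0 ≤ A + area M).trans h)
      two_ne_zero).1 ?_
    rw [hL, hAM]
    ring
  obtain ⟨z, hz⟩ := hM.exists_translate_subset hP hLA hAM
  have hint : (interior M).Nonempty := by
    rw [hMdef, interior_vadd, interior_smul₀ hr.ne']
    exact (hU.interior_symmCircumscribed_nonempty.smul_set).vadd_set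
  have hzA : area (z +ᵥ region P) = area M := by
    rw [hAM, area, measure_vadd]
    rfl
  have hzM := eq_of_subset_of_area_eq (isCompact_region.vadd z).isClosed hM.isCompact hM.convex
    hint hz hzA
  refine ⟨r, -z + x, hr, ?_⟩
  rw [add_vadd, ← hMdef, ← hzM, neg_vadd_vadd]

lemma eq_of_homothety (hU : IsUnitBall U) (hP : IsConvexPolygon P) {c : ℝ} {x : ℝ × ℝ}
    (hc : 0 < c) (h : region P = x +ᵥ c • symmCircumscribed U P) :
    dualLength U P ^ 2 = 4 * area (region P) * area (symmCircumscribed U P) := by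
  -- The bound is attained because `U` touches each of its support lines and is contained in the
  -- symmetrization.
  have hl : ∀ i, sideLevel P i = bracket x (side P i) + c * dualNorm U (side P i) := by
    intro i
    refine le_antisymm ?_ ?_
    · have hi : P i ∈ region P := subset_convexHull ℝ _ ⟨i, rfl⟩
      rw [h] at hi
      obtain ⟨_, ⟨y, hy, rfl⟩, hyi⟩ := hi
      have := (le_abs_self _).trans (hU.mem_symmCircumscribed.1 hy i)
      rw [sideLevel, ← hyi]
      exact (bracket_vadd_smul x y (side P i) c).le.trans
        (add_le_add_right (mul_le_mul_of_nonneg_left this hc.le) _)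
    · obtain ⟨u, hu, hue⟩ := hU.exists_bracket_eq (side P i)
      rw [← hue, ← bracket_vadd_smul]
      refine hP.bracket_le_of_mem_region i ?_
      rw [h]
      exact vadd_mem_vadd_set (smul_mem_smul_set (hU.subset_symmCircumscribed hu))
  have h1 := hP.sum_sideLevel
  simp only [hl] at h1
  rw [sum_bracket_add] at h1
  have h2 : area (region P) = c ^ 2 * area (symmCircumscribed U P) := by
    rw [← area_vadd_smul x, ← h]
  have h3 : c ^ 2 * dualLength U P ^ 2 =
      c ^ 2 * (4 * area (region P) * area (symmCircumscribed U P)) := by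
    rw [← mul_pow, h1]
    linear_combination 4 * area (region P) * h2
  exact mul_left_cancel₀ (by positivity) h3

end IsUnitBall

end NormedPlane

theorem mainTheorem8 (U : Set (ℝ × ℝ)) (hU : NormedPlane.IsUnitBall U)
    (n : ℕ) (K : Polygon (ℝ × ℝ) n) (hK : NormedPlane.IsConvexPolygon K) :
    NormedPlane.dualLength U K ^ 2 / (4 * NormedPlane.area (NormedPlane.symmCircumscribed U K))
        ≥ NormedPlane.area (NormedPlane.region K) ∧
      (NormedPlane.dualLength U K ^ 2 / (4 * NormedPlane.area (NormedPlane.symmCircumscribed U K))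
          = NormedPlane.area (NormedPlane.region K) ↔
        ∃ (c : ℝ) (x : ℝ × ℝ), 0 < c ∧
          NormedPlane.region K = x +ᵥ c • NormedPlane.symmCircumscribed U K) := by
  have hpos := hU.area_symmCircumscribed_pos hK
  have h4 : 0 < 4 * NormedPlane.area (NormedPlane.symmCircumscribed U K) := by positivity
  have hcomm : NormedPlane.area (NormedPlane.region K) *
      (4 * NormedPlane.area (NormedPlane.symmCircumscribed U K)) =
      4 * NormedPlane.area (NormedPlane.region K) *
        NormedPlane.area (NormedPlane.symmCircumscribed U K) := by ring
  constructor
  · rw [ge_iff_le, le_div_iff₀ h4, hcomm]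
    exact hU.four_mul_area_mul_area_le hK
  · rw [div_eq_iff h4.ne', hcomm]
    exact ⟨hU.exists_homothety_of_eq hK, fun ⟨c, x, hc, h⟩ => hU.eq_of_homothety hK hc h⟩
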